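/- For a finite non-abelian group $G$, the centralizer graph $\Gamma_{cent}(G)$ is the simple graph whose vertices are the distinct proper centralizers $C_G(x)\neq G$ ($x\in G$), two distinct vertices being adjacent if and only if they have the same cardinality; the co-centralizer graph $\overline{\Gamma_{cent}(G)}$ is its complement. For a connected graph $H$ with distance matrix $D(H)=(d_{uv})$, let $Tr(H)$ be the diagonal matrix whose $v$-th diagonal entry is $\sum_u d_{vu}$; the distance signless Laplacian spectrum of $H$ is the multiset of eigenvalues (roots of the characteristic polynomial, with multiplicity) of $D^Q(H)=Tr(H)+D(H)$. **Theorem.** Let $k\ge 2$. The graph $\overline{\Gamma_{cent}(PSL(2,2^k))}$ is connected, and its distance signless Laplacian spectrum is the multiset consisting of: (a) $2^{k+1}+2^{2k}-2$ with multiplicity $2^k$; (b) $3\cdot 2^{2k-1}+3\cdot 2^{k-1}-3$ with multiplicity $2^{k-1}(2^k+1)-1$; (c) $3\cdot 2^{2k-1}+2^{k-1}-3$ with multiplicity $2^{k-1}(2^k-1)-1$; and (d) the three eigenvalues, all real and counted with multiplicity, of the matrix $$\mathfrak{D}_P=\begin{bmatrix} 2^{k+1}+2^{2k}-2+2(2^k+1)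 & 2^{k-1}(2^k+1) & 2^{k-1}(2^k-1)\\ 2^k+1 & 3\cdot 2^{2k-1}+3\cdot 2^{k-1}-3+2^k(2^k+1) & 2^{k-1}(2^k-1)\\ 2^k+1 & 2^{k-1}(2^k+1) & 3\cdot 2^{2k-1}+2^{k-1}-3+2^k(2^k-1) \end{bmatrix}.$$ -/

import Mathlib

noncomputable section

namespace CoCentralizer

/-- The proper centralizers of `G`: the subgroups `C_G(x)`, `x ∈ G`, that differ from `G`
(each subgroup counted once, however many elements `x` it arises from). -/
def ProperCentralizer (G : Type*) [Group G] : Type _ :=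
  {H : Subgroup G // (∃ x : G, H = Subgroup.centralizer {x}) ∧ H ≠ ⊤}

instance (G : Type*) [Group G] [Finite G] : Finite (ProperCentralizer G) :=
  inferInstanceAs (Finite {H : Subgroup G // (∃ x : G, H = Subgroup.centralizer {x}) ∧ H ≠ ⊤})

instance (G : Type*) [Group G] [Finite G] : Fintype (ProperCentralizer G) :=
  Fintype.ofFinite _

instance (G : Type*) [Group G] : DecidableEq (ProperCentralizer G) :=
  Classical.decEq _

/-- The centralizer graph: two distinct proper centralizers are adjacent iff they have the
same cardinality. -/
def centralizerGraph (G : Type*) [Group G] : SimpleGraph (ProperCentralizer G) where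
  Adj H K := H ≠ K ∧ Nat.card H.1 = Nat.card K.1
  symm := ⟨fun _ _ h => ⟨h.1.symm, h.2.symm⟩⟩
  loopless := ⟨fun _ h => h.1 rfl⟩

/-- The co-centralizer graph: the complement of the centralizer graph. -/
def coCentralizerGraph (G : Type*) [Group G] : SimpleGraph (ProperCentralizer G) :=
  (centralizerGraph G)ᶜ

section Distance

variable {V : Type*} [Fintype V] [DecidableEq V]

/-- The distance matrix of a graph. -/
def distanceMatrix (H : SimpleGraph V) : Matrix V V ℝ :=
  Matrix.of fun u v => (H.dist u v : ℝ)

/-- The transmission of a vertex: the sum of its distances to all vertices. -/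
def transmission (H : SimpleGraph V) (v : V) : ℝ :=
  ∑ u, (H.dist v u : ℝ)

/-- The distance signless Laplacian matrix `Tr(H) + D(H)`. -/
def distanceSignlessLaplacian (H : SimpleGraph V) : Matrix V V ℝ :=
  Matrix.diagonal (transmission H) + distanceMatrix H

/-- The real spectrum of a matrix: the multiset of real roots of its characteristic polynomial,
each repeated according to its multiplicity. -/
def realSpectrum (M : Matrix V V ℝ) : Multiset ℝ :=
  M.charpoly.roots

end Distance

/-- The group `PSL(2, 2^k)` over the field with `2^k` elements. -/
abbrev PSL2 (k : ℕ) : Type :=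
  Matrix.ProjectiveSpecialLinearGroup (Fin 2) (GaloisField 2 k)

instance (k : ℕ) : Finite (PSL2 k) :=
  haveI : Finite (Matrix.SpecialLinearGroup (Fin 2) (GaloisField 2 k)) :=
    inferInstanceAs (Finite {A : Matrix (Fin 2) (Fin 2) (GaloisField 2 k) // A.det = 1})
  Quotient.finite _

/-- The quotient matrix `𝔇_P` (used for `k ≥ 2`, so that the exponents do not truncate). -/
def quotientMatrix (k : ℕ) : Matrix (Fin 3) (Fin 3) ℝ :=
  !![2 ^ (k + 1) + 2 ^ (2 * k) - 2 + 2 * (2 ^ k + 1),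
      2 ^ (k - 1) * (2 ^ k + 1),
      2 ^ (k - 1) * (2 ^ k - 1);
    2 ^ k + 1,
      3 * 2 ^ (2 * k - 1) + 3 * 2 ^ (k - 1) - 3 + 2 ^ k * (2 ^ k + 1),
      2 ^ (k - 1) * (2 ^ k - 1);
    2 ^ k + 1,
      2 ^ (k - 1) * (2 ^ k + 1),
      3 * 2 ^ (2 * k - 1) + 2 ^ (k - 1) - 3 + 2 ^ k * (2 ^ k - 1)]

end CoCentralizer

end

/-!
Two proper centralizers are adjacent in the co-centralizer graph if and only if their orders differ,
so the graph is complete multipartite, with one part for each order that occurs. Its distance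
signless Laplacian is a diagonal matrix plus a matrix of rank at most the number of parts, both
constant on parts, and `det (1 - A * B) = det (1 - B * A)` factors its characteristic polynomial
through that of the quotient matrix.

Over a field with `q > 2` elements of characteristic two, `PSL₂ = SL₂`, and the commutant of a
nonscalar `2 × 2` matrix `y` is the plane spanned by `1` and `y`. Hence the proper centralizers of
`SL₂` correspond to the classes of commuting nonscalar matrices, each of size `q (q - 1)`. On such a
plane the determinant is a quadratic form, and since every element of the field is a square, the
elements of determinant one and the eigenvalues of `y` together number `q + 1`. The numbers of
centralizers of orders `q`, `q - 1` and `q + 1` (one, two or no eigenvalues) now follow by counting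
nonscalar matrices, those of trace zero, and pairs of a nonscalar matrix and an eigenvalue.
-/

namespace CoCentralizer

open Finset Matrix Polynomial

section BlockMatrix

variable {V ι R : Type*} [DecidableEq ι]

/-- The incidence matrix of the partition of `V` into the fibres of `f`: its `i`-th column is the
indicator of the part `f ⁻¹' {i}`. -/
def partIncidence (R : Type*) [Zero R] [One R] (f : V → ι) : Matrix V ι R :=
  (1 : Matrix ι ι R).submatrix f id

variable {f : V → ι}

theorem diagonal_comp_mul_partIncidence [CommSemiring R] [Fintype V] [DecidableEq V] [Fintype ι]
    (a : ι → R) :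
    diagonal (a ∘ f) * partIncidence R f = partIncidence R f * diagonal a := by
  ext v i
  simp +contextual [partIncidence, one_apply]

theorem submatrix_eq_partIncidence_mul [CommSemiring R] [Fintype ι] (w : Matrix ι ι R) :
    w.submatrix f f = partIncidence R f * w * (partIncidence R f)ᵀ := by
  ext u v
  simp [partIncidence, mul_apply, one_apply]

variable {m : ι → ℕ} [Fintype V]

theorem partIncidence_transpose_mul_self [Semiring R] (hm : ∀ i, #{v | f v = i} = m i) :
    (partIncidence R f)ᵀ * partIncidence R f = diagonal fun i => (m i : R) := by
  ext i j
  simp only [← hm, partIncidence, mul_apply, transpose_apply, submatrix_apply, id, one_apply,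
    mul_ite, mul_one, mul_zero, diagonal_apply, ← ite_and, sum_boole]
  split_ifs with hij
  · simp [hij]
  · rw [filter_eq_empty_iff.mpr, card_empty, Nat.cast_zero]
    rintro v - ⟨rfl, rfl⟩
    exact hij rfl

variable [DecidableEq V] [Fintype ι]

theorem det_diagonal_comp_sub_submatrix_mul_det {K : Type*} [Field K]
    (hm : ∀ i, #{v | f v = i} = m i) {a : ι → K} (ha : ∀ i, a i ≠ 0) (w : Matrix ι ι K) :
    (diagonal (a ∘ f) - w.submatrix f f).det * (diagonal a).det =
      (diagonal (a ∘ f)).det * (diagonal a - w * diagonal fun i => (m i : K)).det := by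
  set N := partIncidence K f
  have hVinv : diagonal (a⁻¹ ∘ f) * diagonal (a ∘ f) = 1 := by simp [ha]
  have hV : diagonal (a ∘ f) - w.submatrix f f =
      (1 - N * (w * Nᵀ * diagonal (a⁻¹ ∘ f))) * diagonal (a ∘ f) := by
    rw [submatrix_eq_partIncidence_mul, Matrix.sub_mul, Matrix.one_mul]
    simp only [Matrix.mul_assoc, hVinv, Matrix.mul_one, N]
  have hι : diagonal a - w * diagonal (fun i => (m i : K)) =
      (1 - w * Nᵀ * diagonal (a⁻¹ ∘ f) * N) * diagonal a := by
    rw [← partIncidence_transpose_mul_self hm, Matrix.sub_mul, Matrix.one_mul]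
    simp only [Matrix.mul_assoc, N, ← diagonal_comp_mul_partIncidence]
    simp only [← Matrix.mul_assoc, hVinv, Matrix.one_mul]
  rw [hV, hι, det_mul, det_mul, det_one_sub_mul_comm]
  ring

theorem det_diagonal_comp_sub_submatrix [CommRing R] [IsDomain R]
    (hm : ∀ i, #{v | f v = i} = m i) (hpos : ∀ i, 0 < m i) {a : ι → R} (ha : ∀ i, a i ≠ 0)
    (w : Matrix ι ι R) :
    (diagonal (a ∘ f) - w.submatrix f f).det =
      (∏ i, a i ^ (m i - 1)) * (diagonal a - w * diagonal fun i => (m i : R)).det := by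
  refine mul_right_cancel₀ (prod_ne_zero_iff.mpr fun i _ => ha i : ∏ i, a i ≠ 0) ?_
  have hfibres : ∏ v, a (f v) = (∏ i, a i ^ (m i - 1)) * ∏ i, a i := by
    simp_rw [← prod_mul_distrib, pow_sub_one_mul (hpos _).ne', ← prod_fiberwise' univ f a,
      prod_const, hm]
  let φ := algebraMap R (FractionRing R)
  have hφ : Function.Injective φ := IsFractionRing.injective _ _
  have hV : diagonal ((φ ∘ a) ∘ f) - (w.map φ).submatrix f f =
      φ.mapMatrix (diagonal (a ∘ f) - w.submatrix f f) := by
    simp [Matrix.map_sub, diagonal_map, Function.comp_assoc, submatrix_map]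
  have hι : diagonal (φ ∘ a) - w.map φ * diagonal (fun i => (m i : FractionRing R)) =
      φ.mapMatrix (diagonal a - w * diagonal fun i => (m i : R)) := by
    simp [Matrix.map_sub, diagonal_map, Function.comp_def]
  have key := det_diagonal_comp_sub_submatrix_mul_det hm (a := φ ∘ a)
    (fun i => (map_ne_zero_iff φ hφ).mpr (ha i)) (w.map φ)
  rw [hV, hι, ← RingHom.map_det, ← RingHom.map_det, det_diagonal, det_diagonal] at key
  simp only [Function.comp_apply, ← map_prod, ← map_mul, hfibres] at key
  rw [hφ key, mul_right_comm]

theorem charpoly_diagonal_comp_add_submatrix [CommRing R] [IsDomain R]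
    (hm : ∀ i, #{v | f v = i} = m i) (hpos : ∀ i, 0 < m i) (d : ι → R) (w : Matrix ι ι R) :
    (diagonal (d ∘ f) + w.submatrix f f).charpoly =
      (∏ i, (X - C (d i)) ^ (m i - 1)) *
        (diagonal d + w * diagonal fun i => (m i : R)).charpoly := by
  convert det_diagonal_comp_sub_submatrix hm hpos (fun i => X_sub_C_ne_zero (d i)) (w.map C) using 1
  · refine congrArg det ?_
    ext u v : 1
    by_cases huv : u = v
    · simp [huv, sub_sub]
    · simp [huv]
  · refine congrArg (_ * det ·) ?_
    ext i j : 1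
    by_cases hij : i = j
    · simp [hij, sub_sub]
    · simp [hij]

end BlockMatrix

theorem splits_charpoly_diagonal_add_mul_diagonal {ι : Type*} [Fintype ι] [DecidableEq ι]
    (d : ι → ℝ) {m : ι → ℝ} (hm : ∀ i, 0 < m i) {w : Matrix ι ι ℝ} (hw : w.IsSymm) :
    (diagonal d + w * diagonal m).charpoly.Splits := by
  have hne : ∀ i, √(m i) ≠ 0 := fun i => (Real.sqrt_pos.mpr (hm i)).ne'
  let S : (Matrix ι ι ℝ)ˣ :=
    ⟨diagonal fun i => √(m i), diagonal fun i => (√(m i))⁻¹, by simp [hne], by simp [hne]⟩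
  have hconj : (S : Matrix ι ι ℝ) * (diagonal d + w * diagonal m) * (S : Matrix ι ι ℝ)⁻¹ =
      diagonal d + Matrix.of fun i j => √(m i) * w i j * √(m j) := by
    have hdiv : ∀ j, m j * (√(m j))⁻¹ = √(m j) := fun j => by rw [← div_eq_mul_inv, Real.div_sqrt]
    rw [← Matrix.coe_units_inv]
    ext i j
    by_cases hij : i = j
    · subst hij
      simp [S, Units.inv_mk, mul_add, add_mul, mul_assoc, hdiv, mul_left_comm _ (d i), hne]
    · simp [S, Units.inv_mk, hij, mul_assoc, hdiv]
  rw [← charpoly_units_conj S, hconj]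
  refine IsHermitian.splits_charpoly ((isHermitian_diagonal d).add (IsHermitian.ext fun i j => ?_))
  simp only [of_apply, star_trivial, hw.apply i j]
  ring

section Multipartite

variable {V ι : Type*} {f : V → ι}

theorem exists_adj_adj_comap_top [Nontrivial ι] (hf : Function.Surjective f) {u v : V}
    (huv : f u = f v) : ∃ x, ((⊤ : SimpleGraph ι).comap f).Adj u x ∧
      ((⊤ : SimpleGraph ι).comap f).Adj x v := by
  obtain ⟨j, hj⟩ := exists_ne (f u)
  obtain ⟨x, rfl⟩ := hf j
  exact ⟨x, hj.symm, fun h => hj (h.trans huv.symm)⟩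

theorem connected_comap_top [Nontrivial ι] (hf : Function.Surjective f) :
    ((⊤ : SimpleGraph ι).comap f).Connected := by
  have : Nonempty V := (hf (Classical.arbitrary ι)).nonempty
  refine ⟨fun u v => ?_⟩
  by_cases huv : f u = f v
  · obtain ⟨x, hux, hxv⟩ := exists_adj_adj_comap_top hf huv
    exact hux.reachable.trans hxv.reachable
  · exact SimpleGraph.Adj.reachable huv

theorem surjective_of_card_fibre_pos [Fintype V] [DecidableEq ι] {m : ι → ℕ}
    (hm : ∀ i, #{v | f v = i} = m i) (hpos : ∀ i, 0 < m i) : Function.Surjective f := fun i => by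
  obtain ⟨v, hv⟩ := card_pos.mp ((hpos i).trans_eq (hm i).symm)
  exact ⟨v, (mem_filter.mp hv).2⟩

/-- The distances between distinct vertices of a complete multipartite graph, as a function of
the parts that contain them. -/
def partDistance (ι : Type*) [DecidableEq ι] : Matrix ι ι ℝ :=
  Matrix.of fun i j => if i = j then 2 else 1

theorem isSymm_partDistance [DecidableEq ι] : (partDistance ι).IsSymm := by
  ext i j
  simp [partDistance, eq_comm]

theorem dist_comap_top_of_ne [Nontrivial ι] [DecidableEq ι] (hf : Function.Surjective f) {u v : V}
    (huv : u ≠ v) : (((⊤ : SimpleGraph ι).comap f).dist u v : ℝ) = partDistance ι (f u) (f v) := by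
  by_cases hfuv : f u = f v
  · obtain ⟨x, hux, hxv⟩ := exists_adj_adj_comap_top hf hfuv
    have hne_one : ((⊤ : SimpleGraph ι).comap f).dist u v ≠ 1 := fun h =>
      SimpleGraph.dist_eq_one_iff_adj.mp h hfuv
    have hpos : 0 < ((⊤ : SimpleGraph ι).comap f).dist u v :=
      (connected_comap_top hf).pos_dist_of_ne huv
    have hle : ((⊤ : SimpleGraph ι).comap f).dist u v ≤ 2 :=
      SimpleGraph.dist_le (.cons hux (.cons hxv .nil))
    have htwo : ((⊤ : SimpleGraph ι).comap f).dist u v = 2 := by omega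
    simp [htwo, partDistance, hfuv]
  · have hone : ((⊤ : SimpleGraph ι).comap f).dist u v = 1 :=
      SimpleGraph.dist_eq_one_iff_adj.mpr hfuv
    simp [hone, partDistance, hfuv]

variable [DecidableEq V] [DecidableEq ι]

theorem distanceMatrix_comap_top [Nontrivial ι] (hf : Function.Surjective f) :
    distanceMatrix ((⊤ : SimpleGraph ι).comap f) =
      (partDistance ι).submatrix f f - diagonal fun _ => 2 := by
  ext u v
  by_cases huv : u = v
  · simp [distanceMatrix, partDistance, huv]
  · simp [distanceMatrix, dist_comap_top_of_ne hf huv, huv]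

/-- The eigenvalue that the part `i` contributes to the distance signless Laplacian spectrum of
the complete multipartite graph with parts of sizes `m`, on vectors that are supported in the part
and have sum zero. -/
def partEigenvalue [Fintype ι] (m : ι → ℕ) (i : ι) : ℝ :=
  ∑ j, (m j : ℝ) + m i - 4

/-- The quotient of the distance signless Laplacian of the complete multipartite graph with parts
of sizes `m` by the partition of the vertices into parts. -/
def multipartiteQuotient [Fintype ι] (m : ι → ℕ) : Matrix ι ι ℝ :=
  diagonal (partEigenvalue m) + partDistance ι * diagonal fun i => (m i : ℝ)

variable [Fintype V] [Fintype ι] {m : ι → ℕ}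

omit [DecidableEq V] in
theorem transmission_comap_top [Nontrivial ι] (hf : Function.Surjective f)
    (hm : ∀ i, #{v | f v = i} = m i) (v : V) :
    transmission ((⊤ : SimpleGraph ι).comap f) v = partEigenvalue m (f v) + 2 := by
  classical
  have hrow : transmission ((⊤ : SimpleGraph ι).comap f) v =
      ∑ u, distanceMatrix ((⊤ : SimpleGraph ι).comap f) v u := rfl
  have hcard : ∑ j, m j = Fintype.card V := by
    simp only [← hm, ← card_univ, ← card_eq_sum_card_fiberwise fun v _ => mem_univ (f v)]
  have hsum : ∑ u, partDistance ι (f v) (f u) = ∑ j, (m j : ℝ) + m (f v) := by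
    have hsplit : ∀ j, partDistance ι (f v) j = 1 + if j = f v then 1 else 0 := fun j => by
      by_cases h : f v = j
      · simp [partDistance, h, one_add_one_eq_two]
      · simp [partDistance, h, Ne.symm h]
    simp only [hsplit, sum_add_distrib, sum_boole, hm, ← Nat.cast_sum, hcard]
    simp
  simp only [hrow, distanceMatrix_comap_top hf, Matrix.sub_apply, submatrix_apply,
    sum_sub_distrib, hsum, diagonal_apply, sum_ite_eq, mem_univ, if_true, partEigenvalue]
  ring

theorem distanceSignlessLaplacian_comap_top [Nontrivial ι] (hf : Function.Surjective f)
    (hm : ∀ i, #{v | f v = i} = m i) :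
    distanceSignlessLaplacian ((⊤ : SimpleGraph ι).comap f) =
      diagonal (partEigenvalue m ∘ f) + (partDistance ι).submatrix f f := by
  have htransmission : diagonal (transmission ((⊤ : SimpleGraph ι).comap f)) =
      diagonal (partEigenvalue m ∘ f) + diagonal fun _ => 2 := by
    rw [diagonal_add]
    exact congrArg diagonal (funext (transmission_comap_top hf hm))
  rw [distanceSignlessLaplacian, htransmission, distanceMatrix_comap_top hf, add_add_sub_cancel]

theorem realSpectrum_distanceSignlessLaplacian_comap_top [Nontrivial ι]
    (hm : ∀ i, #{v | f v = i} = m i) (hpos : ∀ i, 0 < m i) :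
    realSpectrum (distanceSignlessLaplacian ((⊤ : SimpleGraph ι).comap f)) =
      ∑ i, Multiset.replicate (m i - 1) (partEigenvalue m i) +
        realSpectrum (multipartiteQuotient m) := by
  have hprod : ∏ i, (X - C (partEigenvalue m i)) ^ (m i - 1) ≠ 0 :=
    prod_ne_zero_iff.mpr fun i _ => pow_ne_zero _ (X_sub_C_ne_zero _)
  rw [realSpectrum, distanceSignlessLaplacian_comap_top (surjective_of_card_fibre_pos hm hpos) hm,
    charpoly_diagonal_comp_add_submatrix hm hpos,
    roots_mul (mul_ne_zero hprod (charpoly_monic _).ne_zero), roots_prod _ _ hprod]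
  simp only [roots_pow, roots_X_sub_C, Multiset.nsmul_singleton]
  rfl

theorem card_realSpectrum_multipartiteQuotient (hpos : ∀ i, 0 < m i) :
    Multiset.card (realSpectrum (multipartiteQuotient m)) = Fintype.card ι := by
  have hsplits : (multipartiteQuotient m).charpoly.Splits :=
    splits_charpoly_diagonal_add_mul_diagonal _ (fun i => Nat.cast_pos.mpr (hpos i))
      isSymm_partDistance
  rw [realSpectrum, ← hsplits.natDegree_eq_card_roots, charpoly_natDegree_eq_dim]

end Multipartite

section CentralizerOrders

variable {G G' : Type*} [Group G] [Group G']

/-- The number of proper centralizers of order `s` in the group `G`. -/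
noncomputable def numCentralizers (G : Type*) [Group G] (s : ℕ) : ℕ :=
  Nat.card {H : ProperCentralizer G // Nat.card H.1 = s}

section Parts

variable {ι : Type*} {s : ι → ℕ} {f : ProperCentralizer G → ι}

theorem coCentralizerGraph_eq_comap_top (hs : Function.Injective s)
    (hf : ∀ H, Nat.card H.1 = s (f H)) :
    coCentralizerGraph G = (⊤ : SimpleGraph ι).comap f := by
  ext H K
  simp only [coCentralizerGraph, centralizerGraph, SimpleGraph.compl_adj, SimpleGraph.comap_adj,
    SimpleGraph.top_adj, hf, hs.eq_iff]
  exact ⟨fun h hHK => h.2 ⟨h.1, hHK⟩, fun h => ⟨fun hHK => h (congrArg f hHK), fun hHK => h hHK.2⟩⟩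

variable [Finite G]

theorem card_fibre_eq_numCentralizers [DecidableEq ι] (hs : Function.Injective s)
    (hf : ∀ H, Nat.card H.1 = s (f H)) (i : ι) :
    #{H | f H = i} = numCentralizers G (s i) := by
  rw [numCentralizers, Nat.card_eq_fintype_card, Fintype.card_subtype]
  simp only [hf, hs.eq_iff]

theorem sum_properCentralizer_eq_sum_numCentralizers_mul [Fintype ι] (hs : Function.Injective s)
    (hf : ∀ H, Nat.card H.1 = s (f H)) (φ : ℕ → ℕ) :
    ∑ H : ProperCentralizer G, φ (Nat.card H.1) = ∑ i, numCentralizers G (s i) * φ (s i) := by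
  classical
  simp only [hf, ← sum_fiberwise' univ f fun i => φ (s i), sum_const, smul_eq_mul,
    card_fibre_eq_numCentralizers hs hf]

end Parts

theorem map_centralizer_singleton (e : G ≃* G') (x : G) :
    (Subgroup.centralizer {x}).map e.toMonoidHom = Subgroup.centralizer {e x} := by
  refine le_antisymm
    ((Subgroup.map_centralizer_le_centralizer_image _ _).trans_eq (by simp)) fun g hg => ?_
  refine ⟨e.symm g, Subgroup.mem_centralizer_singleton_iff.mpr (e.injective ?_), by simp⟩
  simpa using Subgroup.mem_centralizer_singleton_iff.mp hg

/-- The bijection between the proper centralizers of two isomorphic groups. -/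
def properCentralizerCongr (e : G ≃* G') : ProperCentralizer G ≃ ProperCentralizer G' :=
  Equiv.subtypeEquiv e.mapSubgroup.toEquiv fun H => by
    refine and_congr ⟨?_, ?_⟩ (map_eq_top_iff e.mapSubgroup).symm.not
    · rintro ⟨x, rfl⟩
      exact ⟨e x, map_centralizer_singleton e x⟩
    · rintro ⟨x, hx⟩
      refine ⟨e.symm x, e.mapSubgroup.injective (hx.trans ?_)⟩
      rw [← e.apply_symm_apply x, ← map_centralizer_singleton, e.symm_apply_apply]
      rfl

theorem card_properCentralizerCongr (e : G ≃* G') (H : ProperCentralizer G) :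
    Nat.card (properCentralizerCongr e H).1 = Nat.card H.1 :=
  (Nat.card_congr (e.subgroupMap H.1).toEquiv).symm

theorem numCentralizers_congr (e : G ≃* G') (s : ℕ) :
    numCentralizers G s = numCentralizers G' s :=
  Nat.card_congr ((properCentralizerCongr e).subtypeEquiv fun H => by
    rw [card_properCentralizerCongr])

end CentralizerOrders

section QuadraticForm

variable {F : Type*} [Field F] [Finite F] [CharP F 2]

theorem card_ne_zero_eq_mul_card_eq_one {V : Type*} [MulAction F V] {Q : V → F}
    (hQ : ∀ (c : F) (v : V), Q (c • v) = c ^ 2 * Q v) :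
    Nat.card {v // Q v ≠ 0} = (Nat.card F - 1) * Nat.card {v // Q v = 1} := by
  rw [← Nat.card_units, ← Nat.card_prod]
  refine (Nat.card_congr (Equiv.ofBijective (fun x : Fˣ × {v // Q v = 1} =>
    ⟨(x.1 : F) • x.2.1, by simp [hQ, x.2.2]⟩) ⟨?_, ?_⟩)).symm
  · rintro ⟨a, v, hv⟩ ⟨b, w, hw⟩ hvw
    have hsmul : (a : F) • v = (b : F) • w := congrArg Subtype.val hvw
    have hab : a = b := Units.ext (CharTwo.sq_injective
      (by simpa only [hQ, hv, hw, mul_one] using congrArg Q hsmul))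
    subst hab
    have hvw : v = w := MulAction.injective₀ a.ne_zero hsmul
    simp only [hvw]
  · rintro ⟨v, hv⟩
    obtain ⟨s, hs⟩ := Finite.surjective_of_injective (CharTwo.sq_injective (R := F)) (Q v)
    have hs0 : s ≠ 0 := fun h => hv (by simp [← hs, h])
    refine ⟨⟨Units.mk0 s hs0, s⁻¹ • v, ?_⟩, Subtype.ext (smul_inv_smul₀ hs0 v)⟩
    rw [hQ, ← hs, inv_pow, inv_mul_cancel₀ (pow_ne_zero 2 hs0)]

variable {Q : F × F → F}

omit [CharP F 2] in
/-- The nonzero zeros of `Q` are the nonzero multiples of the zeros `(z, 1)`. -/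
theorem card_eq_zero_eq_mul_card_add_one
    (hQ : ∀ (c : F) (p : F × F), Q (c • p) = c ^ 2 * Q p) (hQ10 : Q (1, 0) ≠ 0) :
    Nat.card {p // Q p = 0} = (Nat.card F - 1) * Nat.card {z // Q (z, 1) = 0} + 1 := by
  have hsnd : ∀ p, Q p = 0 → p.2 = 0 → p = 0 := by
    rintro ⟨a, b⟩ hp (rfl : b = 0)
    have ha : a ^ 2 * Q (1, 0) = 0 := by
      rw [← hQ]
      simpa using hp
    simpa [hQ10] using ha
  let ψ : Fˣ × {z // Q (z, 1) = 0} → F × F := fun x => (x.1 : F) • (x.2.1, 1)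
  have hψ : Function.Injective ψ := by
    rintro ⟨a, z⟩ ⟨b, w⟩ h
    have hab : a = b := Units.ext (by simpa [ψ] using congrArg Prod.snd h)
    subst hab
    have hzw : z = w := Subtype.ext (by simpa [ψ] using congrArg Prod.fst h)
    rw [hzw]
  have hzeros : {p | Q p = 0} = insert 0 (Set.range ψ) := by
    ext p
    constructor
    · intro hp
      refine or_iff_not_imp_left.mpr fun hp0 => ?_
      have hp2 : p.2 ≠ 0 := fun h => hp0 (hsnd p hp h)
      have hscale : p.2⁻¹ • p = (p.2⁻¹ * p.1, 1) := by ext <;> simp [hp2]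
      refine ⟨⟨Units.mk0 p.2 hp2, p.2⁻¹ * p.1, ?_⟩, ?_⟩
      · rw [← hscale, hQ, hp, mul_zero]
      · simp only [ψ, ← hscale, Units.val_mk0, smul_inv_smul₀ hp2]
    · rintro (rfl | ⟨x, rfl⟩)
      · simpa using hQ 0 0
      · simp [ψ, hQ, x.2.2, -Prod.smul_mk]
  have h0 : (0 : F × F) ∉ Set.range ψ := by
    rintro ⟨x, hx⟩
    simpa [ψ] using congrArg Prod.snd hx
  rw [← Nat.card_units, ← Nat.card_prod, ← Set.ncard_range_of_injective hψ,
    ← Set.ncard_insert_of_notMem h0, ← hzeros]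
  rfl

theorem card_eq_one_add_card_eq_zero
    (hQ : ∀ (c : F) (p : F × F), Q (c • p) = c ^ 2 * Q p) (hQ10 : Q (1, 0) ≠ 0) :
    Nat.card {p // Q p = 1} + Nat.card {z // Q (z, 1) = 0} = Nat.card F + 1 := by
  classical
  have htotal := Nat.card_congr (Equiv.sumCompl fun p => Q p = 0)
  rw [Nat.card_sum, card_eq_zero_eq_mul_card_add_one hQ hQ10, card_ne_zero_eq_mul_card_eq_one hQ,
    Nat.card_prod] at htotal
  obtain ⟨m, hm⟩ : ∃ m, Nat.card F = m + 2 := ⟨_, (Nat.sub_add_cancel Finite.one_lt_card).symm⟩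
  rw [hm, Nat.add_succ_sub_one] at htotal
  rw [hm]
  refine Nat.eq_of_mul_eq_mul_left (show 0 < m + 1 from m.succ_pos) ?_
  linear_combination htotal

end QuadraticForm

section Pencil

variable {F : Type*} [Field F] {x y z : Matrix (Fin 2) (Fin 2) F}

/-- A `2 × 2` matrix is nonscalar if it is not a multiple of the identity, equivalently if its
commutant is the algebra that it generates. -/
def IsNonscalar (x : Matrix (Fin 2) (Fin 2) F) : Prop :=
  ∀ a : F, x ≠ a • 1

/-- The matrix `a + b x` in the linear span of `1` and `x`, as a function of the pair `(a, b)`. -/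
def pencil (x : Matrix (Fin 2) (Fin 2) F) (p : F × F) : Matrix (Fin 2) (Fin 2) F :=
  p.1 • 1 + p.2 • x

/-- The number of eigenvalues of `x` in `F`: the determinant of `a + x` vanishes if and only if
`-a` is an eigenvalue. -/
noncomputable def eigenvalueCount (x : Matrix (Fin 2) (Fin 2) F) : ℕ :=
  Nat.card {a : F // (pencil x (a, 1)).det = 0}

theorem commute_pencil (x : Matrix (Fin 2) (Fin 2) F) (p : F × F) : Commute x (pencil x p) :=
  ((Commute.one_right x).smul_right _).add_right ((Commute.refl x).smul_right _)

theorem det_pencil_smul (x : Matrix (Fin 2) (Fin 2) F) (c : F) (p : F × F) :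
    (pencil x (c • p)).det = c ^ 2 * (pencil x p).det := by
  have hsmul : pencil x (c • p) = c • pencil x p := by simp [pencil, mul_smul]
  rw [hsmul, det_smul, Fintype.card_fin]

theorem det_pencil_one (x : Matrix (Fin 2) (Fin 2) F) (a : F) :
    (pencil x (a, 1)).det = a ^ 2 + a * x.trace + x.det := by
  simp only [pencil, det_fin_two, trace_fin_two, Matrix.add_apply, Matrix.smul_apply, one_apply,
    smul_eq_mul]
  simp
  ring

theorem isNonscalar_pencil_iff (hx : IsNonscalar x) (p : F × F) :
    IsNonscalar (pencil x p) ↔ p.2 ≠ 0 := by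
  constructor
  · intro h hp
    exact h p.1 (by simp [pencil, hp])
  · intro hp a ha
    refine hx (p.2⁻¹ * (a - p.1)) ?_
    rw [mul_smul, sub_smul, ← ha, pencil, add_sub_cancel_left, inv_smul_smul₀ hp]

theorem pencil_injective (hx : IsNonscalar x) : Function.Injective (pencil x) := by
  rintro ⟨a, b⟩ ⟨a', b'⟩ h
  have hscalar : pencil x (0, b - b') = (a' - a) • 1 := by
    simp only [pencil] at h ⊢
    rw [zero_smul, zero_add, sub_smul, sub_smul, sub_eq_sub_iff_add_eq_add, add_comm, h, add_comm]
  obtain rfl : b = b' := by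
    by_contra hb
    exact (isNonscalar_pencil_iff hx _).mpr (sub_ne_zero.mpr hb) _ hscalar
  have ha : a = a' := by simpa [pencil] using congrFun (congrFun h 0) 0
  rw [ha]

theorem isNonscalar_iff :
    IsNonscalar x ↔ x 0 1 ≠ 0 ∨ x 1 0 ≠ 0 ∨ x 0 0 - x 1 1 ≠ 0 := by
  rw [← not_iff_not]
  simp only [IsNonscalar, not_forall, not_or, not_not, sub_eq_zero]
  constructor
  · rintro ⟨a, rfl⟩
    simp
  · rintro ⟨h01, h10, hdiag⟩
    refine ⟨x 0 0, ?_⟩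
    ext i j
    fin_cases i <;> fin_cases j <;> simp [h01, h10, hdiag]

/-- Commuting matrices have parallel vectors of off-diagonal entries and diagonal difference. -/
theorem exists_pencil_eq_of_commute (hx : IsNonscalar x) (hxy : Commute x y) :
    ∃ p, pencil x p = y := by
  have h00 := congrFun (congrFun hxy.eq 0) 0
  have h01 := congrFun (congrFun hxy.eq 0) 1
  have h10 := congrFun (congrFun hxy.eq 1) 0
  simp only [mul_apply, Fin.sum_univ_two] at h00 h01 h10
  obtain ⟨b, hb01, hb10, hbdiag⟩ : ∃ b, b * x 0 1 = y 0 1 ∧ b * x 1 0 = y 1 0 ∧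
      b * (x 0 0 - x 1 1) = y 0 0 - y 1 1 := by
    rcases isNonscalar_iff.mp hx with h | h | h
    · refine ⟨y 0 1 / x 0 1, ?_, ?_, ?_⟩ <;> field_simp <;> grind
    · refine ⟨y 1 0 / x 1 0, ?_, ?_, ?_⟩ <;> field_simp <;> grind
    · refine ⟨(y 0 0 - y 1 1) / (x 0 0 - x 1 1), ?_, ?_, ?_⟩ <;> field_simp <;> grind
  refine ⟨(y 0 0 - b * x 0 0, b), ?_⟩
  ext i j
  fin_cases i <;> fin_cases j <;> simp [pencil, hb01, hb10]
  linear_combination -hbdiag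

theorem commute_of_commute_of_commute (hx : IsNonscalar x) (hxy : Commute x y)
    (hxz : Commute x z) : Commute y z := by
  obtain ⟨p, rfl⟩ := exists_pencil_eq_of_commute hx hxy
  exact ((Commute.one_left z).smul_left _).add_left (hxz.smul_left _)

theorem card_isNonscalar_commute [Finite F] (hx : IsNonscalar x) :
    Nat.card {y // IsNonscalar y ∧ Commute x y} = Nat.card F * (Nat.card F - 1) := by
  rw [← Nat.card_units, ← Nat.card_prod]
  refine (Nat.card_congr (Equiv.ofBijective (fun p : F × Fˣ =>
    ⟨pencil x (p.1, p.2), (isNonscalar_pencil_iff hx _).mpr p.2.ne_zero, commute_pencil x _⟩)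
    ⟨?_, ?_⟩)).symm
  · rintro ⟨a, b⟩ ⟨a', b'⟩ h
    obtain ⟨ha, hb⟩ := Prod.ext_iff.mp (pencil_injective hx (congrArg Subtype.val h))
    exact Prod.ext ha (Units.ext hb)
  · rintro ⟨y, hy, hxy⟩
    obtain ⟨p, rfl⟩ := exists_pencil_eq_of_commute hx hxy
    exact ⟨(p.1, Units.mk0 p.2 ((isNonscalar_pencil_iff hx p).mp hy)), rfl⟩

end Pencil

section CommutingSubgroup

variable {F : Type*} [Field F] {x y : Matrix (Fin 2) (Fin 2) F}

/-- The subgroup of `SL₂` of the elements that commute with a given matrix. -/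
def commutingSubgroup (y : Matrix (Fin 2) (Fin 2) F) : Subgroup (SpecialLinearGroup (Fin 2) F) where
  carrier := {g | Commute y g}
  one_mem' := Commute.one_right y
  mul_mem' hg hh := hg.mul_right hh
  inv_mem' {g} hg :=
    (show Commute y (SpecialLinearGroup.toGL g : GL (Fin 2) F) from hg).units_inv_right

theorem mem_commutingSubgroup {g : SpecialLinearGroup (Fin 2) F} :
    g ∈ commutingSubgroup y ↔ Commute y g :=
  Iff.rfl

theorem centralizer_eq_commutingSubgroup (g : SpecialLinearGroup (Fin 2) F) :
    Subgroup.centralizer {g} = commutingSubgroup (g : Matrix (Fin 2) (Fin 2) F) := by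
  ext h
  rw [Subgroup.mem_centralizer_singleton_iff, eq_comm]
  exact Subtype.ext_iff

theorem commutingSubgroup_eq_of_commute (hx : IsNonscalar x) (hy : IsNonscalar y)
    (hxy : Commute x y) : commutingSubgroup x = commutingSubgroup y := by
  ext g
  exact ⟨commute_of_commute_of_commute hx hxy, commute_of_commute_of_commute hy hxy.symm⟩

/-- Otherwise the elementary matrices `!![1, 1; 0, 1]` and `!![1, 0; 1, 1]` would commute. -/
theorem commutingSubgroup_ne_top (hy : IsNonscalar y) : commutingSubgroup y ≠ ⊤ := by
  intro htop
  have hmem : ∀ g : SpecialLinearGroup (Fin 2) F, Commute y g := fun g =>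
    mem_commutingSubgroup.mp (htop ▸ Subgroup.mem_top g)
  have hcomm := commute_of_commute_of_commute hy (hmem ⟨!![1, 1; 0, 1], by simp⟩)
    (hmem ⟨!![1, 0; 1, 1], by simp⟩)
  simpa using congrFun (congrFun hcomm.eq 0) 0

theorem card_commutingSubgroup (hy : IsNonscalar y) :
    Nat.card (commutingSubgroup y) = Nat.card {p // (pencil y p).det = 1} := by
  refine (Nat.card_congr (Equiv.ofBijective (fun p =>
    ⟨⟨pencil y p.1, p.2⟩, commute_pencil y p.1⟩) ⟨?_, ?_⟩)).symm
  · intro p p' h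
    exact Subtype.ext (pencil_injective hy (congrArg (fun g => g.1.1) h))
  · rintro ⟨⟨g, hdet⟩, hg⟩
    obtain ⟨p, rfl⟩ := exists_pencil_eq_of_commute hy hg
    exact ⟨⟨p, hdet⟩, rfl⟩

variable [CharP F 2]

theorem isNonscalar_iff_ne_one (g : SpecialLinearGroup (Fin 2) F) :
    IsNonscalar (g : Matrix (Fin 2) (Fin 2) F) ↔ g ≠ 1 := by
  constructor
  · rintro h rfl
    exact h 1 (by simp)
  · intro hg a ha
    have hdet := g.2
    rw [ha, det_smul, det_one, mul_one, Fintype.card_fin] at hdet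
    obtain rfl : a = 1 := CharTwo.sq_injective (by simpa using hdet)
    exact hg (Subtype.ext (by simpa using ha))

variable (F) in
theorem center_SL_eq_bot : Subgroup.center (SpecialLinearGroup (Fin 2) F) = ⊥ := by
  refine (Subgroup.eq_bot_iff_forall _).mpr fun g hg => ?_
  obtain ⟨a, -, ha⟩ := Matrix.SpecialLinearGroup.mem_center_iff.mp hg
  by_contra hne
  exact (isNonscalar_iff_ne_one g).mpr hne a (by rw [← ha, smul_one_eq_diagonal, scalar_apply])

theorem eigenvalueCount_of_trace_ne_zero (hy : y.trace ≠ 0) :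
    eigenvalueCount y = 0 ∨ eigenvalueCount y = 2 := by
  simp only [eigenvalueCount, det_pencil_one]
  rcases isEmpty_or_nonempty {a : F // a ^ 2 + a * y.trace + y.det = 0} with _ | ⟨s, hs⟩
  · exact Or.inl Nat.card_of_isEmpty
  · have hroot : ∀ a : F, a ^ 2 + a * y.trace + y.det = 0 ↔ a = s ∨ a = s + y.trace := fun a => by
      have hfactor : a ^ 2 + a * y.trace + y.det = (a - s) * (a - (s + y.trace)) := by
        linear_combination
          hs + (a * s + a * y.trace - s ^ 2 - s * y.trace) * CharTwo.two_eq_zero (R := F)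
      rw [hfactor, mul_eq_zero, sub_eq_zero, sub_eq_zero]
    refine Or.inr ((Nat.card_congr (Equiv.subtypeEquivRight hroot)).trans ?_)
    exact Set.ncard_pair (by simpa using hy)

variable [Finite F]

theorem card_commutingSubgroup_add_eigenvalueCount (hy : IsNonscalar y) :
    Nat.card (commutingSubgroup y) + eigenvalueCount y = Nat.card F + 1 := by
  rw [card_commutingSubgroup hy, eigenvalueCount]
  exact card_eq_one_add_card_eq_zero (Q := fun p => (pencil y p).det) (det_pencil_smul y)
    (by simp [pencil])

theorem eigenvalueCount_of_trace_eq_zero (hy : y.trace = 0) : eigenvalueCount y = 1 := by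
  simp only [eigenvalueCount, det_pencil_one, hy, mul_zero, add_zero]
  obtain ⟨s, hs⟩ := Finite.surjective_of_injective (CharTwo.sq_injective (R := F)) y.det
  have hroot : ∀ a : F, a ^ 2 + y.det = 0 ↔ a = s := fun a => by
    rw [CharTwo.add_eq_zero, ← hs]
    exact CharTwo.sq_injective.eq_iff
  simp only [hroot, Nat.card_unique]

theorem card_commutingSubgroup_eq_card_iff (hy : IsNonscalar y) :
    Nat.card (commutingSubgroup y) = Nat.card F ↔ y.trace = 0 := by
  have hcard := card_commutingSubgroup_add_eigenvalueCount hy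
  by_cases htrace : y.trace = 0
  · have := eigenvalueCount_of_trace_eq_zero htrace
    exact iff_of_true (by omega) htrace
  · have := eigenvalueCount_of_trace_ne_zero htrace
    exact iff_of_false (by omega) htrace

end CommutingSubgroup

section MatrixCounts

theorem card_matrix_fin_two (α : Type*) :
    Nat.card (Matrix (Fin 2) (Fin 2) α) = Nat.card α ^ 4 := by
  rw [Matrix, Nat.card_fun, Nat.card_fun, ← pow_mul, Nat.card_fin]

variable {F : Type*} [Field F] [Finite F]

theorem card_eq_card_isNonscalar_and_add_card_scalar (P : Matrix (Fin 2) (Fin 2) F → Prop) :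
    Nat.card {y // P y} =
      Nat.card {y // IsNonscalar y ∧ P y} + Nat.card {a : F // P (a • 1)} := by
  classical
  have hscalar : Nat.card {y // ¬IsNonscalar y ∧ P y} = Nat.card {a : F // P (a • 1)} := by
    refine (Nat.card_congr (Equiv.ofBijective
      (fun a => ⟨a.1 • 1, fun h => h a.1 rfl, a.2⟩) ⟨fun a b hab => Subtype.ext ?_, ?_⟩)).symm
    · simpa using congrFun (congrFun (congrArg Subtype.val hab) 0) 0
    · rintro ⟨y, hy, hP⟩
      simp only [IsNonscalar, not_forall, not_not] at hy
      obtain ⟨a, rfl⟩ := hy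
      exact ⟨⟨a, hP⟩, rfl⟩
  rw [← hscalar, ← Nat.card_congr (Equiv.sumCompl fun y : {y // P y} => IsNonscalar y.1),
    Nat.card_sum]
  have hcomm : ∀ R : Matrix (Fin 2) (Fin 2) F → Prop,
      Nat.card {y : {y // P y} // R y.1} = Nat.card {y // R y ∧ P y} := fun R =>
    Nat.card_congr ((Equiv.subtypeSubtypeEquivSubtypeInter P R).trans
      (Equiv.subtypeEquivRight fun _ => and_comm))
  rw [hcomm, hcomm fun y => ¬IsNonscalar y]

variable (F) in
theorem card_isNonscalar :
    Nat.card {y : Matrix (Fin 2) (Fin 2) F // IsNonscalar y} =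
      Nat.card F * (Nat.card F - 1) * (Nat.card F ^ 2 + Nat.card F + 1) := by
  have hsplit := card_eq_card_isNonscalar_and_add_card_scalar (F := F) fun _ => True
  simp only [and_true, Nat.card_congr (Equiv.subtypeUnivEquiv fun _ => trivial),
    card_matrix_fin_two] at hsplit
  obtain ⟨m, hm⟩ : ∃ m, Nat.card F = m + 1 := ⟨_, (Nat.sub_add_cancel Finite.one_lt_card.le).symm⟩
  rw [hm] at hsplit ⊢
  rw [Nat.add_sub_cancel]
  linear_combination -hsplit

variable (F) in
theorem card_isNonscalar_trace_eq_zero [CharP F 2] :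
    Nat.card {y : Matrix (Fin 2) (Fin 2) F // IsNonscalar y ∧ y.trace = 0} =
      Nat.card F * (Nat.card F - 1) * (Nat.card F + 1) := by
  have hsplit := card_eq_card_isNonscalar_and_add_card_scalar (F := F) fun y => y.trace = 0
  have htrace : Nat.card {y : Matrix (Fin 2) (Fin 2) F // y.trace = 0} = Nat.card (F × F × F) :=
    Nat.card_congr
      { toFun := fun y => (y.1 0 0, y.1 0 1, y.1 1 0)
        invFun := fun p => ⟨!![p.1, p.2.1; p.2.2, -p.1], by simp [trace_fin_two]⟩
        left_inv := fun y => by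
          have hy := y.2
          rw [trace_fin_two, add_comm] at hy
          rw [Subtype.ext_iff, eta_fin_two y.1, eq_neg_of_add_eq_zero_left hy]
        right_inv := fun p => rfl }
  have hscalar : ∀ a : F, (a • (1 : Matrix (Fin 2) (Fin 2) F)).trace = 0 := fun a => by
    simp [CharTwo.two_eq_zero]
  rw [htrace, Nat.card_congr (Equiv.subtypeUnivEquiv hscalar), Nat.card_prod, Nat.card_prod]
    at hsplit
  obtain ⟨m, hm⟩ : ∃ m, Nat.card F = m + 1 := ⟨_, (Nat.sub_add_cancel Finite.one_lt_card.le).symm⟩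
  rw [hm] at hsplit ⊢
  rw [Nat.add_sub_cancel]
  linear_combination -hsplit

variable (F) in
theorem card_isNonscalar_det_eq_zero :
    Nat.card {y : Matrix (Fin 2) (Fin 2) F // IsNonscalar y ∧ y.det = 0} =
      (Nat.card F - 1) * (Nat.card F + 1) ^ 2 := by
  classical
  have hsplit := card_eq_card_isNonscalar_and_add_card_scalar (F := F) fun y => y.det = 0
  have hscalar : Nat.card {a : F // (a • (1 : Matrix (Fin 2) (Fin 2) F)).det = 0} = 1 := by
    simp
  have hGL : Nat.card {y : Matrix (Fin 2) (Fin 2) F // y.det ≠ 0} = Nat.card (GL (Fin 2) F) :=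
    Nat.card_congr
      { toFun := fun y => GeneralLinearGroup.mkOfDetNeZero y.1 y.2
        invFun := fun g => ⟨g, GeneralLinearGroup.det_ne_zero g⟩
        left_inv := fun y => rfl
        right_inv := fun g => Units.ext rfl }
  have htotal := Nat.card_congr
    (Equiv.sumCompl fun y : Matrix (Fin 2) (Fin 2) F => y.det = 0)
  have := Fintype.ofFinite F
  rw [Nat.card_sum, hsplit, hscalar, hGL, card_GL_field, card_matrix_fin_two,
    ← Nat.card_eq_fintype_card, Fin.prod_univ_two] at htotal
  obtain ⟨m, hm⟩ : ∃ m, Nat.card F = m + 1 := ⟨_, (Nat.sub_add_cancel Finite.one_lt_card.le).symm⟩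
  rw [hm] at htotal ⊢
  have hsub0 : (m + 1) ^ 2 - (m + 1) ^ ((0 : Fin 2) : ℕ) = m * (m + 2) :=
    Nat.sub_eq_of_eq_add (by simp; ring)
  have hsub1 : (m + 1) ^ 2 - (m + 1) ^ ((1 : Fin 2) : ℕ) = (m + 1) * m :=
    Nat.sub_eq_of_eq_add (by simp; ring)
  rw [hsub0, hsub1] at htotal
  rw [Nat.add_sub_cancel]
  linear_combination htotal

/-- Shifting by an eigenvalue turns pairs of a matrix and an eigenvalue into pairs of a scalar and
a singular matrix. -/
theorem sum_eigenvalueCount [Fintype {y : Matrix (Fin 2) (Fin 2) F // IsNonscalar y}] :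
    ∑ y : {y : Matrix (Fin 2) (Fin 2) F // IsNonscalar y}, eigenvalueCount y.1 =
      Nat.card F * Nat.card {y : Matrix (Fin 2) (Fin 2) F // IsNonscalar y ∧ y.det = 0} := by
  have hshift : ∀ (a : F) (y : Matrix (Fin 2) (Fin 2) F),
      pencil (pencil y (a, 1)) (-a, 1) = y := fun a y => by simp [pencil]
  simp only [eigenvalueCount]
  rw [← Nat.card_sigma, ← Nat.card_prod]
  exact Nat.card_congr
    { toFun := fun y => (y.2.1, ⟨pencil y.1.1 (y.2.1, 1),
        (isNonscalar_pencil_iff y.1.2 _).mpr one_ne_zero, y.2.2⟩)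
      invFun := fun p => ⟨⟨pencil p.2.1 (-p.1, 1),
        (isNonscalar_pencil_iff p.2.2.1 _).mpr one_ne_zero⟩, p.1, by
          simpa [pencil] using p.2.2.2⟩
      left_inv := fun y => Sigma.subtype_ext (Subtype.ext (hshift _ _)) rfl
      right_inv := fun p => Prod.ext rfl (Subtype.ext
        (by simpa only [neg_neg] using hshift (-p.1) p.2.1)) }

end MatrixCounts

section CountSL

variable {F : Type*} [Field F] [Finite F] [CharP F 2]

theorem exists_mem_commutingSubgroup_isNonscalar (hq : 2 < Nat.card F)
    {y : Matrix (Fin 2) (Fin 2) F} (hy : IsNonscalar y) :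
    ∃ g ∈ commutingSubgroup y, IsNonscalar (g : Matrix (Fin 2) (Fin 2) F) := by
  have hcard : 1 < Nat.card (commutingSubgroup y) := by
    have := card_commutingSubgroup_add_eigenvalueCount hy
    by_cases htrace : y.trace = 0
    · have := eigenvalueCount_of_trace_eq_zero htrace
      omega
    · have := eigenvalueCount_of_trace_ne_zero htrace
      omega
  obtain ⟨g, hg⟩ := Subgroup.ne_bot_iff_exists_ne_one.mp
    ((Subgroup.one_lt_card_iff_ne_bot _).mp hcard)
  exact ⟨g, g.2, (isNonscalar_iff_ne_one g.1).mpr fun h => hg (Subtype.ext h)⟩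

theorem commutingSubgroup_eq_iff_commute (hq : 2 < Nat.card F) {x y : Matrix (Fin 2) (Fin 2) F}
    (hx : IsNonscalar x) (hy : IsNonscalar y) :
    commutingSubgroup x = commutingSubgroup y ↔ Commute x y := by
  refine ⟨fun h => ?_, commutingSubgroup_eq_of_commute hx hy⟩
  obtain ⟨g, hgx, hg⟩ := exists_mem_commutingSubgroup_isNonscalar hq hx
  have hgy : Commute y g := mem_commutingSubgroup.mp (h ▸ hgx)
  exact commute_of_commute_of_commute hg (Commute.symm hgx) hgy.symm

/-- The proper centralizer of `SL₂` formed by the elements that commute with a given nonscalar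
matrix. -/
def toProperCentralizer (hq : 2 < Nat.card F)
    (y : {y : Matrix (Fin 2) (Fin 2) F // IsNonscalar y}) :
    ProperCentralizer (SpecialLinearGroup (Fin 2) F) :=
  ⟨commutingSubgroup y.1, by
    obtain ⟨g, hgy, hg⟩ := exists_mem_commutingSubgroup_isNonscalar hq y.2
    exact ⟨g, (commutingSubgroup_eq_of_commute y.2 hg hgy).trans
      (centralizer_eq_commutingSubgroup g).symm⟩, commutingSubgroup_ne_top y.2⟩

theorem toProperCentralizer_surjective (hq : 2 < Nat.card F) :
    Function.Surjective (toProperCentralizer (F := F) hq) := by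
  rintro ⟨_, ⟨g, rfl⟩, htop⟩
  have hg : IsNonscalar (g : Matrix (Fin 2) (Fin 2) F) := by
    refine (isNonscalar_iff_ne_one g).mpr ?_
    rintro rfl
    exact htop (Subgroup.centralizer_eq_top_iff_subset.mpr (by simp))
  exact ⟨⟨g, hg⟩, Subtype.ext (centralizer_eq_commutingSubgroup g).symm⟩

theorem card_toProperCentralizer_fibre (hq : 2 < Nat.card F)
    (H : ProperCentralizer (SpecialLinearGroup (Fin 2) F)) :
    Nat.card {y // toProperCentralizer hq y = H} = Nat.card F * (Nat.card F - 1) := by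
  obtain ⟨x, rfl⟩ := toProperCentralizer_surjective hq H
  rw [← card_isNonscalar_commute x.2]
  refine Nat.card_congr ((Equiv.subtypeEquivRight fun y => ?_).trans
    (Equiv.subtypeSubtypeEquivSubtypeInter IsNonscalar (Commute x.1)))
  rw [← commutingSubgroup_eq_iff_commute hq x.2 y.2, eq_comm]
  exact Subtype.ext_iff

theorem sum_isNonscalar_eq_mul_sum_properCentralizer (hq : 2 < Nat.card F)
    [Fintype {y : Matrix (Fin 2) (Fin 2) F // IsNonscalar y}] (φ : ℕ → ℕ) :
    ∑ y : {y : Matrix (Fin 2) (Fin 2) F // IsNonscalar y}, φ (Nat.card (commutingSubgroup y.1)) =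
      Nat.card F * (Nat.card F - 1) *
        ∑ H : ProperCentralizer (SpecialLinearGroup (Fin 2) F), φ (Nat.card H.1) := by
  have hfibre : ∀ H : ProperCentralizer (SpecialLinearGroup (Fin 2) F),
      #{y | toProperCentralizer hq y = H} = Nat.card F * (Nat.card F - 1) := fun H => by
    rw [← card_toProperCentralizer_fibre hq H, Nat.card_eq_fintype_card, Fintype.card_subtype]
  rw [mul_sum]
  refine (sum_fiberwise' univ (toProperCentralizer hq) fun H => φ (Nat.card H.1)).symm.trans ?_
  simp only [sum_const, hfibre, smul_eq_mul]

end CountSL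

section CentralizerNumbers

/-- The orders of the proper centralizers of `SL₂` over a field with `q` elements, `q` even: a
nonscalar matrix with one, two or no eigenvalues has `q`, `q - 1` or `q + 1` commuting elements. -/
def centralizerOrder (q : ℕ) : Fin 3 → ℕ :=
  ![q, q - 1, q + 1]

theorem centralizerOrder_injective {q : ℕ} (hq : 0 < q) :
    Function.Injective (centralizerOrder q) := by
  intro i j h
  fin_cases i <;> fin_cases j <;> simp [centralizerOrder] at h ⊢ <;> omega

variable {F : Type*} [Field F] [Finite F]

variable (F) in
theorem card_mul_card_sub_one_pos : 0 < Nat.card F * (Nat.card F - 1) :=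
  Nat.mul_pos Nat.card_pos (Nat.sub_pos_of_lt Finite.one_lt_card)

variable [CharP F 2]

theorem exists_card_properCentralizer_eq (hq : 2 < Nat.card F)
    (H : ProperCentralizer (SpecialLinearGroup (Fin 2) F)) :
    ∃ i, Nat.card H.1 = centralizerOrder (Nat.card F) i := by
  obtain ⟨y, rfl⟩ := toProperCentralizer_surjective hq H
  change ∃ i, Nat.card (commutingSubgroup y.1) = _
  have hcard := card_commutingSubgroup_add_eigenvalueCount y.2
  by_cases htrace : y.1.trace = 0
  · have hone := eigenvalueCount_of_trace_eq_zero htrace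
    exact ⟨0, by simp [centralizerOrder]; omega⟩
  · rcases eigenvalueCount_of_trace_ne_zero htrace with hnone | htwo
    · exact ⟨2, by simp [centralizerOrder]; omega⟩
    · exact ⟨1, by simp [centralizerOrder]; omega⟩

theorem sum_isNonscalar_eq_mul_sum_numCentralizers (hq : 2 < Nat.card F)
    [Fintype {y : Matrix (Fin 2) (Fin 2) F // IsNonscalar y}] (φ : ℕ → ℕ) :
    ∑ y : {y : Matrix (Fin 2) (Fin 2) F // IsNonscalar y}, φ (Nat.card (commutingSubgroup y.1)) =
      Nat.card F * (Nat.card F - 1) *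
        ∑ i, numCentralizers (SpecialLinearGroup (Fin 2) F) (centralizerOrder (Nat.card F) i) *
          φ (centralizerOrder (Nat.card F) i) := by
  choose f hf using exists_card_properCentralizer_eq (F := F) hq
  rw [sum_isNonscalar_eq_mul_sum_properCentralizer hq,
    sum_properCentralizer_eq_sum_numCentralizers_mul
      (centralizerOrder_injective (by omega)) hf]

theorem numCentralizers_SL_card (hq : 2 < Nat.card F) :
    numCentralizers (SpecialLinearGroup (Fin 2) F) (Nat.card F) = Nat.card F + 1 := by
  classical
  have := Fintype.ofFinite {y : Matrix (Fin 2) (Fin 2) F // IsNonscalar y}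
  have hsum := sum_isNonscalar_eq_mul_sum_numCentralizers hq
    fun s => if s = Nat.card F then 1 else 0
  have htrace : #{y : {y : Matrix (Fin 2) (Fin 2) F // IsNonscalar y} | y.1.trace = 0} =
      Nat.card F * (Nat.card F - 1) * (Nat.card F + 1) := by
    rw [← card_isNonscalar_trace_eq_zero, ← Fintype.card_subtype, ← Nat.card_eq_fintype_card]
    exact Nat.card_congr (Equiv.subtypeSubtypeEquivSubtypeInter IsNonscalar (trace · = 0))
  have hne : Nat.card F - 1 ≠ Nat.card F := by omega
  simp only [card_commutingSubgroup_eq_card_iff (Subtype.prop _), sum_boole, Nat.cast_id, htrace,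
    Fin.sum_univ_three, centralizerOrder, Matrix.cons_val, if_true, hne,
    Nat.succ_ne_self, if_false, mul_zero, add_zero, mul_one] at hsum
  exact (Nat.eq_of_mul_eq_mul_left (card_mul_card_sub_one_pos F) hsum).symm

theorem numCentralizers_SL_add_add (hq : 2 < Nat.card F) :
    numCentralizers (SpecialLinearGroup (Fin 2) F) (Nat.card F) +
      numCentralizers (SpecialLinearGroup (Fin 2) F) (Nat.card F - 1) +
      numCentralizers (SpecialLinearGroup (Fin 2) F) (Nat.card F + 1) =
        Nat.card F ^ 2 + Nat.card F + 1 := by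
  have := Fintype.ofFinite {y : Matrix (Fin 2) (Fin 2) F // IsNonscalar y}
  have hsum := sum_isNonscalar_eq_mul_sum_numCentralizers hq fun _ => 1
  simp only [sum_const, card_univ, ← Nat.card_eq_fintype_card, card_isNonscalar, smul_eq_mul,
    mul_one, Fin.sum_univ_three, centralizerOrder, Matrix.cons_val] at hsum
  exact (Nat.eq_of_mul_eq_mul_left (card_mul_card_sub_one_pos F) hsum).symm

/-- Counts the pairs of a nonscalar matrix and one of its eigenvalues. -/
theorem numCentralizers_SL_add_two_mul (hq : 2 < Nat.card F) :
    numCentralizers (SpecialLinearGroup (Fin 2) F) (Nat.card F) +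
      2 * numCentralizers (SpecialLinearGroup (Fin 2) F) (Nat.card F - 1) =
        (Nat.card F + 1) ^ 2 := by
  have := Fintype.ofFinite {y : Matrix (Fin 2) (Fin 2) F // IsNonscalar y}
  have hsum := sum_isNonscalar_eq_mul_sum_numCentralizers hq fun s => Nat.card F + 1 - s
  have hcount : ∀ y : {y : Matrix (Fin 2) (Fin 2) F // IsNonscalar y},
      Nat.card F + 1 - Nat.card (commutingSubgroup y.1) = eigenvalueCount y.1 := fun y => by
    rw [← card_commutingSubgroup_add_eigenvalueCount y.2, Nat.add_sub_cancel_left]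
  have hone : Nat.card F + 1 - Nat.card F = 1 := by omega
  have htwo : Nat.card F + 1 - (Nat.card F - 1) = 2 := by omega
  simp only [hcount, sum_eigenvalueCount, card_isNonscalar_det_eq_zero, ← mul_assoc,
    Fin.sum_univ_three, centralizerOrder, Matrix.cons_val, hone, htwo, Nat.sub_self, mul_zero,
    add_zero, mul_one] at hsum
  rw [mul_comm 2]
  exact (Nat.eq_of_mul_eq_mul_left (card_mul_card_sub_one_pos F) hsum).symm

theorem two_mul_numCentralizers_SL_card_sub_one (hq : 2 < Nat.card F) :
    2 * numCentralizers (SpecialLinearGroup (Fin 2) F) (Nat.card F - 1) =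
      Nat.card F * (Nat.card F + 1) := by
  linear_combination numCentralizers_SL_add_two_mul hq - numCentralizers_SL_card hq

theorem two_mul_numCentralizers_SL_card_add_one (hq : 2 < Nat.card F) :
    2 * numCentralizers (SpecialLinearGroup (Fin 2) F) (Nat.card F + 1) =
      Nat.card F * (Nat.card F - 1) := by
  obtain ⟨m, hm⟩ : ∃ m, Nat.card F = m + 1 := ⟨_, (Nat.sub_add_cancel Finite.one_lt_card.le).symm⟩
  have hq' := numCentralizers_SL_card hq
  have hsub := two_mul_numCentralizers_SL_card_sub_one hq
  have hadd := numCentralizers_SL_add_add hq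
  rw [hm] at hq' hsub hadd ⊢
  rw [Nat.add_sub_cancel] at hsub hadd ⊢
  linear_combination 2 * hadd - 2 * hq' - hsub

end CentralizerNumbers

section PSL

/-- The isomorphism `PSL(2, 2 ^ k) ≃ SL(2, 2 ^ k)`, the center being trivial in characteristic
two. -/
noncomputable def pslEquiv (k : ℕ) : PSL2 k ≃* SpecialLinearGroup (Fin 2) (GaloisField 2 k) :=
  (QuotientGroup.quotientMulEquivOfEq (center_SL_eq_bot (GaloisField 2 k))).trans
    QuotientGroup.quotientBot

/-- The numbers of proper centralizers of `PSL(2, 2 ^ k)` of orders `2 ^ k`, `2 ^ k - 1` and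
`2 ^ k + 1`, in the order of `centralizerOrder`. -/
def centralizerCount (k : ℕ) : Fin 3 → ℕ :=
  ![2 ^ k + 1, 2 ^ (k - 1) * (2 ^ k + 1), 2 ^ (k - 1) * (2 ^ k - 1)]

theorem centralizerCount_pos {k : ℕ} (hk : k ≠ 0) (i : Fin 3) : 0 < centralizerCount k i := by
  have hpow : 0 < 2 ^ k - 1 := Nat.sub_pos_of_lt (Nat.one_lt_two_pow hk)
  fin_cases i <;> simp only [centralizerCount, Fin.zero_eta, Fin.mk_one, Fin.reduceFinMk,
    Matrix.cons_val] <;> positivity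

theorem two_lt_card_galoisField {k : ℕ} (hk : 2 ≤ k) : 2 < Nat.card (GaloisField 2 k) :=
  (lt_self_pow₀ one_lt_two hk).trans_eq (GaloisField.card 2 k (by omega)).symm

theorem numCentralizers_PSL2 {k : ℕ} (hk : 2 ≤ k) (i : Fin 3) :
    numCentralizers (PSL2 k) (centralizerOrder (2 ^ k) i) = centralizerCount k i := by
  have hcard := GaloisField.card 2 k (by omega)
  have hq := two_lt_card_galoisField hk
  have hone := numCentralizers_SL_card hq
  have htwo := two_mul_numCentralizers_SL_card_sub_one hq
  have hnone := two_mul_numCentralizers_SL_card_add_one hq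
  rw [hcard] at hone htwo hnone
  have hpow : 2 ^ k = 2 * 2 ^ (k - 1) := (mul_pow_sub_one (by omega) 2).symm
  rw [numCentralizers_congr (pslEquiv k)]
  fin_cases i
  · exact hone
  · refine Nat.eq_of_mul_eq_mul_left two_pos (htwo.trans ?_)
    simp only [centralizerCount, Fin.mk_one, Matrix.cons_val, ← mul_assoc, ← hpow]
  · refine Nat.eq_of_mul_eq_mul_left two_pos (hnone.trans ?_)
    simp only [centralizerCount, Fin.reduceFinMk, Matrix.cons_val, ← mul_assoc, ← hpow]

theorem exists_coCentralizerGraph_PSL2_eq_comap_top {k : ℕ} (hk : 2 ≤ k) :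
    ∃ f : ProperCentralizer (PSL2 k) → Fin 3,
      coCentralizerGraph (PSL2 k) = (⊤ : SimpleGraph (Fin 3)).comap f ∧
        ∀ i, #{H | f H = i} = centralizerCount k i := by
  have hcard := GaloisField.card 2 k (by omega)
  have hq := two_lt_card_galoisField hk
  have horder : ∀ H : ProperCentralizer (PSL2 k),
      ∃ i, Nat.card H.1 = centralizerOrder (2 ^ k) i := fun H => by
    rw [← card_properCentralizerCongr (pslEquiv k), ← hcard]
    exact exists_card_properCentralizer_eq hq _
  choose f hf using horder
  have hinj := centralizerOrder_injective (q := 2 ^ k) (by positivity)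
  exact ⟨f, coCentralizerGraph_eq_comap_top hinj hf, fun i =>
    (card_fibre_eq_numCentralizers hinj hf i).trans (numCentralizers_PSL2 hk i)⟩

theorem cast_centralizerCount_two (k : ℕ) :
    (centralizerCount k 2 : ℝ) = 2 ^ (k - 1) * (2 ^ k - 1) := by
  simp [centralizerCount, Nat.cast_sub Nat.one_le_two_pow]

theorem partEigenvalue_centralizerCount {k : ℕ} (hk : k ≠ 0) :
    partEigenvalue (centralizerCount k) =
      ![2 ^ (k + 1) + 2 ^ (2 * k) - 2, 3 * 2 ^ (2 * k - 1) + 3 * 2 ^ (k - 1) - 3,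
        3 * 2 ^ (2 * k - 1) + 2 ^ (k - 1) - 3] := by
  obtain ⟨n, rfl⟩ := Nat.exists_eq_succ_of_ne_zero hk
  have hexp : 2 * (n + 1) - 1 = 2 * n + 1 := by omega
  ext i
  rw [partEigenvalue, Fin.sum_univ_three, cast_centralizerCount_two]
  fin_cases i <;> simp [centralizerCount, hexp] <;> ring

theorem quotientMatrix_eq_multipartiteQuotient {k : ℕ} (hk : k ≠ 0) :
    quotientMatrix k = multipartiteQuotient (centralizerCount k) := by
  obtain ⟨n, rfl⟩ := Nat.exists_eq_succ_of_ne_zero hk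
  ext i j
  rw [multipartiteQuotient, partEigenvalue_centralizerCount hk, Matrix.add_apply, mul_diagonal,
    diagonal_apply]
  fin_cases i <;> fin_cases j <;>
    simp [quotientMatrix, partDistance, centralizerCount] <;> ring

end PSL

end CoCentralizer

theorem mainTheorem2 (k : ℕ) (hk : 2 ≤ k) :
    (CoCentralizer.coCentralizerGraph (CoCentralizer.PSL2 k)).Connected ∧
    Multiset.card (CoCentralizer.realSpectrum (CoCentralizer.quotientMatrix k)) = 3 ∧
    CoCentralizer.realSpectrum
        (CoCentralizer.distanceSignlessLaplacian
          (CoCentralizer.coCentralizerGraph (CoCentralizer.PSL2 k))) =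
      Multiset.replicate (2 ^ k) ((2 : ℝ) ^ (k + 1) + 2 ^ (2 * k) - 2) +
      Multiset.replicate (2 ^ (k - 1) * (2 ^ k + 1) - 1)
        (3 * (2 : ℝ) ^ (2 * k - 1) + 3 * 2 ^ (k - 1) - 3) +
      Multiset.replicate (2 ^ (k - 1) * (2 ^ k - 1) - 1)
        (3 * (2 : ℝ) ^ (2 * k - 1) + 2 ^ (k - 1) - 3) +
      CoCentralizer.realSpectrum (CoCentralizer.quotientMatrix k) := by
  obtain ⟨f, hgraph, hcard⟩ := CoCentralizer.exists_coCentralizerGraph_PSL2_eq_comap_top hk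
  have hk0 : k ≠ 0 := by omega
  have hpos := CoCentralizer.centralizerCount_pos hk0
  have hsurj := CoCentralizer.surjective_of_card_fibre_pos hcard hpos
  rw [hgraph, CoCentralizer.quotientMatrix_eq_multipartiteQuotient hk0]
  refine ⟨CoCentralizer.connected_comap_top hsurj,
    CoCentralizer.card_realSpectrum_multipartiteQuotient hpos, ?_⟩
  rw [CoCentralizer.realSpectrum_distanceSignlessLaplacian_comap_top hcard hpos,
    Fin.sum_univ_three, CoCentralizer.partEigenvalue_centralizerCount hk0]
  rfl
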